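/- Let $N\ge 3$, and let $\operatorname{Conf}(N)$ be the space of configurations $U=(u_1,\dots,u_N)$ of $N$ distinct labeled points of the unit sphere $\mathbb S^2\subset\mathbb R^3$. Write $\theta(x,y)\in[0,\pi]$ for the angular distance of $x,y\in\mathbb S^2$, and let $$\rho(U)=\tfrac12\min_{i\ne j}\theta(u_i,u_j)$$ be the injectivity radius. For a tangent vector $V=(v_1,\dots,v_N)$, $v_i\perp u_i$, put $U\#tV=\big((u_i+tv_i)/|u_i+tv_i|\big)_{i=1}^N$. A configuration $U$ is critical (for maximizing $\rho$) if $\max\{\rho(U\#tV)-\rho(U),0\}=o(t)$ as $t\to0$ for every tangent vector $V$. A number $c>0$ is a topologically regular value of $\rho$ if for some $0<\varepsilon<c$ the superlevel set $\{\rho\ge c-\varepsilon\}\subset\operatorname{Conf}(N)$ strongly deformation retracts onto $\{\rho\ge c+\varepsilon\}$ (both may be empty). A number $c>0$ is a critical value of $\rho$ if $c=\rho(U)$ for some critical configuration $U$, or if $c$ is not a topologically regular value of $\rho$. The contact graph of $U$ has as vertices the points $u_i$, and as edges the geodesic segments $[u_i,u_j]$, $i\neq j$, with $\theta(u_i,u_j)=2\rho(U)$.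 The configuration $U$ is balanced if there are nonnegative weights $w_e$, not all zero, on the edges $e$ of its contact graph such that for every $i$ $$\sum_{e\ni u_i} w_e\,T_e|_{u_i}=0,$$ where the sum is over the edges $e$ with endpoint $u_i$, and $T_e|_{u_i}$ is the outward unit tangent vector of $e$ at $u_i$. **Theorem.** Let $\theta>0$ be such that $\theta/2$ is a critical value of $\rho$. Then there is a balanced configuration $U\in\operatorname{Conf}(N)$ with $\rho(U)=\theta/2$. The vertices of its contact graph are among the points of $U$, and all geodesic edges of its contact graph have (angular) length $\theta$. -/

import Mathlib

open scoped InnerProductSpace Topology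

namespace SphereConf

/-- The unit sphere in Euclidean 3-space. -/
abbrev S2 : Type := Metric.sphere (0 : EuclideanSpace ℝ (Fin 3)) 1

/-- Angular distance: the angle subtended at the center of the sphere. It is also the length of
the geodesic segment joining two points. -/
noncomputable def angDist (x y : S2) : ℝ :=
  InnerProductGeometry.angle (x : EuclideanSpace ℝ (Fin 3)) (y : EuclideanSpace ℝ (Fin 3))

/-- The space of configurations of `N` distinct labeled points of the sphere. -/
def Conf (N : ℕ) : Set (Fin N → S2) := {U | Function.Injective U}

/-- Configurations whose points are pairwise at angular distance at least `θ`. -/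
def ConfGE (N : ℕ) (θ : ℝ) : Set (Fin N → S2) :=
  {U | U ∈ Conf N ∧ ∀ i j, i < j → θ ≤ angDist (U i) (U j)}

/-- The injectivity radius: half of the minimal angular distance between two points with different
labels. (For `2 ≤ N` the infimum is over a finite nonempty family, so it is a minimum.) -/
noncomputable def injRadius {N : ℕ} (U : Fin N → S2) : ℝ :=
  (1 / 2) * ⨅ p : {p : Fin N × Fin N // p.1 ≠ p.2}, angDist (U p.1.1) (U p.1.2)

/-- The tangent plane of the sphere at `x`: the vectors orthogonal to `x`. -/
noncomputable abbrev TanAt (x : S2) : Submodule ℝ (EuclideanSpace ℝ (Fin 3)) :=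
  (Submodule.span ℝ {(x : EuclideanSpace ℝ (Fin 3))})ᗮ

theorem add_smul_ne_zero (x : S2) (v : TanAt x) (t : ℝ) :
    (x : EuclideanSpace ℝ (Fin 3)) + t • (v : EuclideanSpace ℝ (Fin 3)) ≠ 0 := by
  intro h
  have hv : ⟪(x : EuclideanSpace ℝ (Fin 3)), (v : EuclideanSpace ℝ (Fin 3))⟫_ℝ = 0 :=
    Submodule.mem_orthogonal_singleton_iff_inner_right.mp v.2
  have hx : ‖(x : EuclideanSpace ℝ (Fin 3))‖ = 1 := by simp
  have h2 := congrArg (fun z => ⟪(x : EuclideanSpace ℝ (Fin 3)), z⟫_ℝ) h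
  simp [inner_add_right, inner_smul_right, hv] at h2

/-- Move the point `x` along the tangent vector `t v` and project back to the sphere:
`(x + t v) / |x + t v|`. -/
noncomputable def movePoint (x : S2) (v : TanAt x) (t : ℝ) : S2 :=
  ⟨‖(x : EuclideanSpace ℝ (Fin 3)) + t • (v : EuclideanSpace ℝ (Fin 3))‖⁻¹ •
      ((x : EuclideanSpace ℝ (Fin 3)) + t • (v : EuclideanSpace ℝ (Fin 3))), by
    rw [mem_sphere_zero_iff_norm]
    exact norm_smul_inv_norm (𝕜 := ℝ) (add_smul_ne_zero x v t)⟩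

/-- The varied configuration `U # tV`. -/
noncomputable def vary {N : ℕ} (U : Fin N → S2) (V : ∀ i, TanAt (U i)) (t : ℝ) : Fin N → S2 :=
  fun i => movePoint (U i) (V i) t

/-- `U` is critical for maximizing the injectivity radius: no tangent variation increases it to
first order. -/
def IsCritical {N : ℕ} (U : Fin N → S2) : Prop :=
  U ∈ Conf N ∧ ∀ V : ∀ i, TanAt (U i),
    (fun t : ℝ => max (injRadius (vary U V t) - injRadius U) 0) =o[𝓝 0] (fun t : ℝ => t)

/-- The subspace `A` (strongly) deformation retracts onto its subspace `B`. -/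
def DeformationRetractsOnto {X : Type*} [TopologicalSpace X] (A B : Set X) : Prop :=
  B ⊆ A ∧ ∃ r : C(A, A), (∀ x, (r x : X) ∈ B) ∧
    Nonempty ((ContinuousMap.id A).HomotopyRel r {x : A | (x : X) ∈ B})

/-- The value `c` of the injectivity radius `ρ` is topologically regular: for some `ε`, the
superlevel set `{ρ ≥ c - ε}` deformation retracts onto the superlevel set `{ρ ≥ c + ε}`. -/
def IsTopologicallyRegularValue (N : ℕ) (c : ℝ) : Prop :=
  ∃ ε : ℝ, 0 < ε ∧ ε < c ∧
    DeformationRetractsOnto (ConfGE N (2 * (c - ε))) (ConfGE N (2 * (c + ε)))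

/-- `c` is a critical value of the injectivity radius on configurations of `N` points: the value at
a critical configuration, or a value that is not topologically regular. Both senses of "critical
value" are thereby covered. -/
def IsCriticalValue (N : ℕ) (c : ℝ) : Prop :=
  (∃ U : Fin N → S2, IsCritical U ∧ injRadius U = c) ∨ ¬ IsTopologicallyRegularValue N c

/-- The contact graph of `U` at angle `θ`, as a graph on points of the sphere: its vertices are the
points of `U`, and two of them are joined (by the geodesic segment between them) exactly if
they are at angular distance `θ`. -/
def contactGraph {N : ℕ} (θ : ℝ) (U : Fin N → S2) : (⊤ : SimpleGraph S2).Subgraph where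
  verts := Set.range U
  Adj x y := x ∈ Set.range U ∧ y ∈ Set.range U ∧ x ≠ y ∧ angDist x y = θ
  adj_sub h := h.2.2.1
  edge_vert h := h.1
  symm := ⟨fun _ _ h => ⟨h.2.1, h.1, h.2.2.1.symm,
    (InnerProductGeometry.angle_comm _ _).trans h.2.2.2⟩⟩

/-- The outward unit tangent vector at its endpoint `x` of the geodesic segment from `y` to `x`:
the normalized projection of `-y` to the tangent plane at `x` (for `y ≠ ± x`). -/
noncomputable def outwardTangent (x y : S2) : EuclideanSpace ℝ (Fin 3) :=
  let p : EuclideanSpace ℝ (Fin 3) :=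
    ⟪(x : EuclideanSpace ℝ (Fin 3)), (y : EuclideanSpace ℝ (Fin 3))⟫_ℝ •
      (x : EuclideanSpace ℝ (Fin 3)) - (y : EuclideanSpace ℝ (Fin 3))
  ‖p‖⁻¹ • p

open Classical in
/-- The edge weights `w` on the contact graph of `U` at angle `θ` form a balanced stress graph: they
are nonnegative on edges, and at every point of `U` the tangential forces sum to zero. (Only the
values of `w` at edges of the contact graph matter.) -/
def IsBalancedStress {N : ℕ} (θ : ℝ) (U : Fin N → S2) (w : Sym2 S2 → ℝ) : Prop :=
  (∀ e ∈ (contactGraph θ U).edgeSet, 0 ≤ w e) ∧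
  ∀ i, ∑ j with (contactGraph θ U).Adj (U i) (U j),
    w s(U i, U j) • outwardTangent (U i) (U j) = 0

/-- `U` is balanced: its contact graph, i.e. the one at the minimal angle `2 ρ(U)` (at smaller
angles there is no edge), has a balanced stress graph whose weights are not all zero. -/
def IsBalanced {N : ℕ} (U : Fin N → S2) : Prop :=
  U ∈ Conf N ∧ ∃ w : Sym2 S2 → ℝ, IsBalancedStress (2 * injRadius U) U w ∧
    ∃ e ∈ (contactGraph (2 * injRadius U) U).edgeSet, w e ≠ 0

end SphereConf

namespace SphereConf

/-! ### Angular distance and its minimum -/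

/-- The minimal angular distance between two points of a configuration. -/
noncomputable def minDist {N : ℕ} (U : Fin N → S2) : ℝ :=
  ⨅ p : {p : Fin N × Fin N // p.1 ≠ p.2}, angDist (U p.1.1) (U p.1.2)

theorem two_mul_injRadius {N : ℕ} (U : Fin N → S2) : 2 * injRadius U = minDist U := by
  unfold injRadius minDist; ring

theorem nonempty_pairs {N : ℕ} (hN : 2 ≤ N) : Nonempty {p : Fin N × Fin N // p.1 ≠ p.2} :=
  ⟨⟨(⟨0, by omega⟩, ⟨1, by omega⟩), by simp⟩⟩

theorem minDist_le {N : ℕ} (U : Fin N → S2) {i j : Fin N} (h : i ≠ j) :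
    minDist U ≤ angDist (U i) (U j) :=
  ciInf_le (Set.finite_range _).bddBelow (⟨(i, j), h⟩ : {p : Fin N × Fin N // p.1 ≠ p.2})

theorem exists_angDist_eq_minDist {N : ℕ} (hN : 2 ≤ N) (U : Fin N → S2) :
    ∃ i j, i ≠ j ∧ angDist (U i) (U j) = minDist U := by
  have := nonempty_pairs hN
  obtain ⟨⟨⟨i, j⟩, h⟩, hp⟩ := exists_eq_ciInf_of_finite
    (f := fun p : {p : Fin N × Fin N // p.1 ≠ p.2} => angDist (U p.1.1) (U p.1.2))
  exact ⟨i, j, h, hp⟩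

theorem le_minDist_iff {N : ℕ} (hN : 2 ≤ N) (U : Fin N → S2) {a : ℝ} :
    a ≤ minDist U ↔ ∀ i j, i ≠ j → a ≤ angDist (U i) (U j) := by
  refine ⟨fun h i j hij => h.trans (minDist_le U hij), fun h => ?_⟩
  obtain ⟨i, j, hij, he⟩ := exists_angDist_eq_minDist hN U
  exact he ▸ h i j hij

theorem lt_minDist_iff {N : ℕ} (hN : 2 ≤ N) (U : Fin N → S2) {a : ℝ} :
    a < minDist U ↔ ∀ i j, i ≠ j → a < angDist (U i) (U j) := by
  refine ⟨fun h i j hij => h.trans_le (minDist_le U hij), fun h => ?_⟩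
  obtain ⟨i, j, hij, he⟩ := exists_angDist_eq_minDist hN U
  exact he ▸ h i j hij

theorem angDist_comm (x y : S2) : angDist x y = angDist y x :=
  InnerProductGeometry.angle_comm _ _

theorem cos_angDist (x y : S2) :
    Real.cos (angDist x y) = ⟪(x : EuclideanSpace ℝ (Fin 3)), (y : EuclideanSpace ℝ (Fin 3))⟫_ℝ := by
  simp [angDist, InnerProductGeometry.cos_angle]

theorem angDist_nonneg (x y : S2) : 0 ≤ angDist x y := InnerProductGeometry.angle_nonneg _ _

theorem angDist_le_pi (x y : S2) : angDist x y ≤ Real.pi := InnerProductGeometry.angle_le_pi _ _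

theorem angDist_lt_angDist_iff {x y x' y' : S2} :
    angDist x y < angDist x' y' ↔
      ⟪(x' : EuclideanSpace ℝ (Fin 3)), (y' : EuclideanSpace ℝ (Fin 3))⟫_ℝ <
      ⟪(x : EuclideanSpace ℝ (Fin 3)), (y : EuclideanSpace ℝ (Fin 3))⟫_ℝ := by
  rw [← cos_angDist, ← cos_angDist]
  exact (Real.strictAntiOn_cos.lt_iff_gt ⟨angDist_nonneg _ _, angDist_le_pi _ _⟩
    ⟨angDist_nonneg _ _, angDist_le_pi _ _⟩).symm

theorem angDist_self (x : S2) : angDist x x = 0 :=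
  InnerProductGeometry.angle_self
    (norm_ne_zero_iff.1 (by rw [norm_eq_of_mem_sphere x]; exact one_ne_zero))

theorem continuous_angDist {Y : Type*} [TopologicalSpace Y] {f g : Y → S2} (hf : Continuous f)
    (hg : Continuous g) : Continuous fun y => angDist (f y) (g y) := by
  have : (fun y => angDist (f y) (g y)) = fun y =>
      Real.arccos ⟪(f y : EuclideanSpace ℝ (Fin 3)), (g y : EuclideanSpace ℝ (Fin 3))⟫_ℝ := by
    funext y; simp [angDist, InnerProductGeometry.angle]
  rw [this]
  fun_prop

theorem continuous_minDist {N : ℕ} (hN : 2 ≤ N) :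
    Continuous (minDist : (Fin N → S2) → ℝ) := by
  have := nonempty_pairs hN
  have h : (minDist : (Fin N → S2) → ℝ) = fun U =>
      (Finset.univ : Finset {p : Fin N × Fin N // p.1 ≠ p.2}).inf' Finset.univ_nonempty
        fun p => angDist (U p.1.1) (U p.1.2) := by
    funext U
    rw [Finset.inf'_univ_eq_ciInf]; rfl
  have hc : ∀ p : {p : Fin N × Fin N // p.1 ≠ p.2},
      Continuous fun U : Fin N → S2 => angDist (U p.1.1) (U p.1.2) := fun p =>
    continuous_angDist (continuous_apply _) (continuous_apply _)
  rw [h]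
  exact Continuous.finset_inf'_apply (f := fun (p : {p : Fin N × Fin N // p.1 ≠ p.2})
    (U : Fin N → S2) => angDist (U p.1.1) (U p.1.2)) Finset.univ_nonempty fun p _ => hc p

theorem injective_of_minDist_pos {N : ℕ} {U : Fin N → S2} (h : 0 < minDist U) :
    Function.Injective U := by
  intro i j hij
  by_contra hne
  have := minDist_le U hne
  rw [hij, angDist_self] at this
  linarith

theorem mem_ConfGE_iff {N : ℕ} (hN : 2 ≤ N) {a : ℝ} (ha : 0 < a) {U : Fin N → S2} :
    U ∈ ConfGE N a ↔ a ≤ minDist U := by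
  rw [le_minDist_iff hN]
  constructor
  · rintro ⟨-, h⟩ i j hij
    rcases lt_or_gt_of_ne hij with h' | h'
    · exact h i j h'
    · rw [angDist_comm]; exact h j i h'
  · intro h
    exact ⟨injective_of_minDist_pos (ha.trans_le ((le_minDist_iff hN U).2 h)),
      fun i j hij => h i j hij.ne⟩

/-! ### Variations and first-order rates -/

/-- The orthogonal projection of an ambient vector to the tangent plane. -/
noncomputable def tanProj (x : S2) (v : EuclideanSpace ℝ (Fin 3)) : TanAt x :=
  ⟨v - ⟪(x : EuclideanSpace ℝ (Fin 3)), v⟫_ℝ • (x : EuclideanSpace ℝ (Fin 3)), 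
    Submodule.mem_orthogonal_singleton_iff_inner_right.mpr (by
      rw [inner_sub_right, inner_smul_right, real_inner_self_eq_norm_sq, norm_eq_of_mem_sphere]
      ring)⟩

theorem coe_tanProj (x : S2) (v : EuclideanSpace ℝ (Fin 3)) :
    (tanProj x v : EuclideanSpace ℝ (Fin 3)) =
      v - ⟪(x : EuclideanSpace ℝ (Fin 3)), v⟫_ℝ • (x : EuclideanSpace ℝ (Fin 3)) := rfl

theorem inner_tanProj (x : S2) (v : EuclideanSpace ℝ (Fin 3)) :
    ⟪(x : EuclideanSpace ℝ (Fin 3)), (tanProj x v : EuclideanSpace ℝ (Fin 3))⟫_ℝ = 0 :=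
  Submodule.mem_orthogonal_singleton_iff_inner_right.mp (tanProj x v).2

/-- The variation of `U` along the tangential part of the ambient vectors `X`. -/
noncomputable def push {N : ℕ} (U : Fin N → S2) (X : Fin N → EuclideanSpace ℝ (Fin 3)) (t : ℝ) :
    Fin N → S2 :=
  vary U (fun i => tanProj (U i) (X i)) t

/-- The unnormalized position of the `i`-th point of `push U X t`. -/
noncomputable def rawPush {N : ℕ} (U : Fin N → S2) (X : Fin N → EuclideanSpace ℝ (Fin 3)) (t : ℝ)
    (i : Fin N) : EuclideanSpace ℝ (Fin 3) :=
  (U i : EuclideanSpace ℝ (Fin 3)) + t • (tanProj (U i) (X i) : EuclideanSpace ℝ (Fin 3))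

section push

variable {N : ℕ} (U : Fin N → S2) (X : Fin N → EuclideanSpace ℝ (Fin 3)) (t : ℝ) (i j : Fin N)

theorem rawPush_ne_zero : rawPush U X t i ≠ 0 := add_smul_ne_zero _ _ _

theorem coe_push :
    (push U X t i : EuclideanSpace ℝ (Fin 3)) = ‖rawPush U X t i‖⁻¹ • rawPush U X t i := rfl

theorem push_zero : push U X 0 = U := by
  funext i
  apply Subtype.ext
  simp [coe_push, rawPush]

/-- The velocity of the normalization `p / ‖p‖` when `p` has velocity `v`. -/
noncomputable def unitVel (p v : EuclideanSpace ℝ (Fin 3)) : EuclideanSpace ℝ (Fin 3) :=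
  ‖p‖⁻¹ • v - (⟪p, v⟫_ℝ * ‖p‖⁻¹ ^ 3) • p

/-- The derivative in `t` of the inner product of two points of `push U X t`. -/
noncomputable def innerRate : ℝ :=
  ⟪(push U X t i : EuclideanSpace ℝ (Fin 3)),
    unitVel (rawPush U X t j) (tanProj (U j) (X j))⟫_ℝ +
  ⟪unitVel (rawPush U X t i) (tanProj (U i) (X i)),
    (push U X t j : EuclideanSpace ℝ (Fin 3))⟫_ℝ

theorem hasDerivAt_normalize (a v : EuclideanSpace ℝ (Fin 3)) (h : a + t • v ≠ 0) :
    HasDerivAt (fun s : ℝ => ‖a + s • v‖⁻¹ • (a + s • v)) (unitVel (a + t • v) v) t := by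
  have h1 : HasDerivAt (fun s : ℝ => a + s • v) v t := by
    simpa using ((hasDerivAt_id t).smul_const v).const_add a
  have hn : ‖a + t • v‖ ≠ 0 := norm_ne_zero_iff.2 h
  have h2 : HasDerivAt (fun s : ℝ => ‖a + s • v‖) (⟪a + t • v, v⟫_ℝ / ‖a + t • v‖) t := by
    have h3 := h1.norm_sq.sqrt (pow_ne_zero 2 hn)
    simp only [Real.sqrt_sq (norm_nonneg _)] at h3
    convert h3 using 1
    field_simp
  refine ((h2.fun_inv hn).fun_smul h1).congr_deriv ?_
  rw [unitVel, sub_eq_add_neg, ← neg_smul]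
  congr 2
  field_simp

theorem hasDerivAt_inner_push :
    HasDerivAt (fun s => ⟪(push U X s i : EuclideanSpace ℝ (Fin 3)),
      (push U X s j : EuclideanSpace ℝ (Fin 3))⟫_ℝ) (innerRate U X t i j) t :=
  (hasDerivAt_normalize t _ _ (rawPush_ne_zero U X t i)).inner ℝ
    (hasDerivAt_normalize t _ _ (rawPush_ne_zero U X t j))

theorem innerRate_zero : innerRate U X 0 i j =
    ⟪(U i : EuclideanSpace ℝ (Fin 3)), (tanProj (U j) (X j) : EuclideanSpace ℝ (Fin 3))⟫_ℝ +
    ⟪(tanProj (U i) (X i) : EuclideanSpace ℝ (Fin 3)), (U j : EuclideanSpace ℝ (Fin 3))⟫_ℝ := by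
  simp [innerRate, push_zero, unitVel, rawPush, inner_tanProj]

end push

section continuity

variable {N : ℕ} {Y : Type*} [TopologicalSpace Y] {U : Y → Fin N → S2}
  {X : Y → Fin N → EuclideanSpace ℝ (Fin 3)} {t : Y → ℝ}

theorem continuous_rawPush (hU : Continuous U) (hX : Continuous X) (ht : Continuous t) (i : Fin N) :
    Continuous fun y => rawPush (U y) (X y) (t y) i := by
  unfold rawPush
  simp only [coe_tanProj]
  fun_prop

theorem continuous_push (hU : Continuous U) (hX : Continuous X) (ht : Continuous t) :
    Continuous fun y => push (U y) (X y) (t y) := by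
  refine continuous_pi fun i => Continuous.subtype_mk (?_ : Continuous fun y =>
    ‖rawPush (U y) (X y) (t y) i‖⁻¹ • rawPush (U y) (X y) (t y) i) _
  have := continuous_rawPush hU hX ht i
  exact (this.norm.inv₀ fun y => norm_ne_zero_iff.2 (rawPush_ne_zero _ _ _ _)).smul this

theorem continuous_innerRate (hU : Continuous U) (hX : Continuous X) (ht : Continuous t)
    (i j : Fin N) : Continuous fun y => innerRate (U y) (X y) (t y) i j := by
  have hp : ∀ i, Continuous fun y => (push (U y) (X y) (t y) i : EuclideanSpace ℝ (Fin 3)) :=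
    fun i => continuous_subtype_val.comp ((continuous_apply i).comp (continuous_push hU hX ht))
  have hv : ∀ i, Continuous fun y =>
      unitVel (rawPush (U y) (X y) (t y) i) (tanProj (U y i) (X y i)) := by
    intro i
    have h1 := continuous_rawPush hU hX ht i
    have h2 := h1.norm.inv₀ fun y => norm_ne_zero_iff.2 (rawPush_ne_zero (U y) (X y) (t y) i)
    have h3 : Continuous fun y => (tanProj (U y i) (X y i) : EuclideanSpace ℝ (Fin 3)) := by
      simp only [coe_tanProj]; fun_prop
    unfold unitVel
    exact (h2.smul h3).sub (((h1.inner h3).mul (h2.pow 3)).smul h1)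
  exact ((hp i).inner (hv j)).add ((hv i).inner (hp j))

end continuity

/-! ### Gordan's alternative -/

/-- Gordan's alternative for a linear map to a finite power of `ℝ`. -/
theorem exists_nonneg_combination_eq_zero {ι E : Type*} [Fintype ι] [AddCommGroup E] [Module ℝ E]
    (L : E →ₗ[ℝ] (ι → ℝ)) (h : ¬ ∃ x, ∀ i, L x i < 0) :
    ∃ w : ι → ℝ, (∀ i, 0 ≤ w i) ∧ (∃ i, w i ≠ 0) ∧ ∀ x, ∑ i, w i * L x i = 0 := by
  classical
  have hs : IsOpen {a : ι → ℝ | ∀ i, a i < 0} := by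
    simp only [Set.ofPred_forall]
    exact isOpen_iInter_of_finite fun i => isOpen_lt (continuous_apply i) continuous_const
  have hc : Convex ℝ {a : ι → ℝ | ∀ i, a i < 0} := by
    simp only [Set.ofPred_forall]
    exact convex_iInter fun i => convex_halfSpace_lt (LinearMap.proj i).isLinear 0
  -- The range misses the open negative orthant; the coordinates of a separating functional are the
  -- weights.
  have hd : Disjoint {a : ι → ℝ | ∀ i, a i < 0} (LinearMap.range L : Set (ι → ℝ)) := by
    rw [Set.disjoint_left]
    rintro _ ha ⟨x, rfl⟩
    exact h ⟨x, ha⟩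
  obtain ⟨f, u, hf, hu⟩ :=
    geometric_hahn_banach_open hc hs (LinearMap.range L).convex hd
  have hu0 : u ≤ 0 := by simpa using hu 0 (Submodule.zero_mem _)
  have hneg : ∀ a : ι → ℝ, (∀ i, a i < 0) → f a < 0 := fun a ha => (hf a ha).trans_le hu0
  have hsum : ∀ a : ι → ℝ, f a = ∑ i, f (Pi.single i 1) * a i := by
    intro a
    conv_lhs => rw [← Finset.univ_sum_single a]
    rw [map_sum]
    refine Finset.sum_congr rfl fun i _ => ?_
    rw [show (Pi.single i (a i) : ι → ℝ) = a i • Pi.single i 1 by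
      rw [← Pi.single_smul, smul_eq_mul, mul_one], map_smul, smul_eq_mul, mul_comm]
  have hm : f (fun _ => -1) < 0 := hneg _ fun _ => by norm_num
  refine ⟨fun i => f (Pi.single i 1), fun i => ?_, ?_, fun x => ?_⟩
  -- Subtracting a positive multiple of the basis vector keeps all coordinates negative but brings
  -- the functional up to `0`.
  · by_contra! hi
    have hq : 0 < f (fun _ => -1) / f (Pi.single i 1) := div_pos_of_neg_of_neg hm hi
    have := hneg ((fun _ => -1) - (f (fun _ => -1) / f (Pi.single i 1)) • Pi.single i 1) fun j => by
      have : (0 : ℝ) ≤ (Pi.single i 1 : ι → ℝ) j := by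
        rw [Pi.single_apply]; split_ifs <;> norm_num
      simp only [Pi.sub_apply, Pi.smul_apply, smul_eq_mul]
      nlinarith [mul_nonneg hq.le this]
    rw [map_sub, map_smul, smul_eq_mul, div_mul_cancel₀ _ hi.ne] at this
    linarith
  · by_contra! h0
    rw [hsum] at hm
    simp [h0] at hm
  · rw [← hsum]
    by_contra hx
    -- A functional bounded below on a subspace vanishes there: otherwise rescaling attains `u - 1`.
    have := hu (L (((u - 1) / f (L x)) • x)) ⟨_, rfl⟩
    rw [map_smul, map_smul, smul_eq_mul, div_mul_cancel₀ _ hx] at this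
    linarith

/-- Gordan's alternative for the coordinates in a finite set. -/
theorem exists_weights_of_finset {ι E : Type*} [Fintype ι] [AddCommGroup E] [Module ℝ E]
    (L : E →ₗ[ℝ] (ι → ℝ)) (s : Set ι) (h : ¬ ∃ x, ∀ i ∈ s, L x i < 0) :
    ∃ w : ι → ℝ, (∀ i, 0 ≤ w i) ∧ (∀ i, i ∉ s → w i = 0) ∧ (∃ i ∈ s, w i ≠ 0) ∧
      ∀ x, ∑ i, w i * L x i = 0 := by
  classical
  obtain ⟨w, hw, ⟨i, hi⟩, h0⟩ := exists_nonneg_combination_eq_zero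
    ((LinearMap.funLeft ℝ ℝ (Subtype.val : s → ι)).comp L)
    (fun ⟨x, hx⟩ => h ⟨x, fun i hi => hx ⟨i, hi⟩⟩)
  refine ⟨fun i => if h : i ∈ s then w ⟨i, h⟩ else 0, fun i => ?_, fun i hi => dif_neg hi,
    ⟨i, i.2, by simpa using hi⟩, fun x => ?_⟩
  · dsimp only
    split_ifs
    exacts [hw _, le_rfl]
  · refine Eq.trans ?_ (h0 x)
    rw [← Finset.sum_subset (Finset.subset_univ s.toFinset),
      Finset.sum_subtype s.toFinset (p := (· ∈ s)) (by simp)]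
    · exact Finset.sum_congr rfl fun i _ => by simp [LinearMap.funLeft_apply]
    · intro i _ hi
      dsimp only
      rw [dif_neg fun h => hi (Set.mem_toFinset.2 h), zero_mul]

/-! ### Balanced stress from the absence of lengthening variations -/

/-- To first order, the variation `push U X` lengthens every edge of the contact graph of
`push U X t`. -/
def LengthensContacts {N : ℕ} (U : Fin N → S2) (X : Fin N → EuclideanSpace ℝ (Fin 3)) (t : ℝ) :
    Prop :=
  ∀ i j, i ≠ j → angDist (push U X t i) (push U X t j) = minDist (push U X t) →
    innerRate U X t i j < 0

theorem lengthensContacts_zero {N : ℕ} {U : Fin N → S2} {X : Fin N → EuclideanSpace ℝ (Fin 3)} :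
    LengthensContacts U X 0 ↔
      ∀ i j, i ≠ j → angDist (U i) (U j) = minDist U → innerRate U X 0 i j < 0 := by
  simp only [LengthensContacts, push_zero]

/-- The component of `y` orthogonal to `x`. -/
noncomputable def tangentTo (x y : S2) : EuclideanSpace ℝ (Fin 3) :=
  (y : EuclideanSpace ℝ (Fin 3)) -
    ⟪(x : EuclideanSpace ℝ (Fin 3)), (y : EuclideanSpace ℝ (Fin 3))⟫_ℝ •
      (x : EuclideanSpace ℝ (Fin 3))

/-- The normalizing factor depends only on the edge length, so it is common to all contact edges and
factors out of the force balance. For antipodal points both sides are zero. -/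
theorem outwardTangent_eq (x y : S2) :
    outwardTangent x y = -((√(1 - Real.cos (angDist x y) ^ 2))⁻¹ • tangentTo x y) := by
  have hn : ‖tangentTo x y‖ = √(1 - Real.cos (angDist x y) ^ 2) := by
    have hsq : ‖tangentTo x y‖ ^ 2 = 1 - Real.cos (angDist x y) ^ 2 := by
      rw [tangentTo, norm_sub_sq_real, norm_smul, norm_eq_of_mem_sphere, norm_eq_of_mem_sphere,
        real_inner_smul_right, real_inner_comm, ← cos_angDist, angDist_comm y x,
        Real.norm_eq_abs, mul_one, sq_abs]
      ring
    rw [← hsq, Real.sqrt_sq (norm_nonneg _)]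
  have : outwardTangent x y = ‖-tangentTo x y‖⁻¹ • (-tangentTo x y) := by
    simp only [tangentTo, neg_sub]; rfl
  rw [this, norm_neg, hn, smul_neg]

theorem innerRate_zero_eq {N : ℕ} (U : Fin N → S2) (X : Fin N → EuclideanSpace ℝ (Fin 3))
    (i j : Fin N) : innerRate U X 0 i j =
      ⟪X i, tangentTo (U i) (U j)⟫_ℝ + ⟪X j, tangentTo (U j) (U i)⟫_ℝ := by
  rw [innerRate_zero, coe_tanProj, coe_tanProj, tangentTo, tangentTo]
  simp only [inner_sub_left, inner_sub_right, real_inner_smul_left, real_inner_smul_right]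
  rw [real_inner_comm (U i : EuclideanSpace ℝ (Fin 3)) (X i),
    real_inner_comm (U j : EuclideanSpace ℝ (Fin 3)) (X j),
    real_inner_comm (X j) (U i : EuclideanSpace ℝ (Fin 3)),
    real_inner_comm (U j : EuclideanSpace ℝ (Fin 3)) (U i : EuclideanSpace ℝ (Fin 3))]
  ring

/-- A configuration without a variation that lengthens all edges of its contact graph to first
order is balanced. -/
theorem isBalanced_of_not_lengthensContacts {N : ℕ} {U : Fin N → S2} (hN : 2 ≤ N)
    (hpos : 0 < minDist U) (h : ¬ ∃ X, LengthensContacts U X 0) : IsBalanced U := by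
  classical
  have hinj := injective_of_minDist_pos hpos
  have : Nonempty (Fin N) := ⟨⟨0, by omega⟩⟩
  let L : (Fin N → EuclideanSpace ℝ (Fin 3)) →ₗ[ℝ] (Fin N × Fin N → ℝ) :=
    { toFun := fun X p => innerRate U X 0 p.1 p.2
      map_add' := fun X Y => by
        funext p
        simp only [innerRate_zero_eq, Pi.add_apply, inner_add_left]
        ring
      map_smul' := fun c X => by
        funext p
        simp only [innerRate_zero_eq, Pi.smul_apply, real_inner_smul_left, RingHom.id_apply,
          smul_eq_mul]
        ring }
  have hL : ∀ X p, L X p = ⟪X p.1, tangentTo (U p.1) (U p.2)⟫_ℝ +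
      ⟪X p.2, tangentTo (U p.2) (U p.1)⟫_ℝ := fun X p => innerRate_zero_eq U X p.1 p.2
  obtain ⟨w, hw, hws, ⟨⟨a, b⟩, hab, hwab⟩, h0⟩ := exists_weights_of_finset L
    {p | p.1 ≠ p.2 ∧ angDist (U p.1) (U p.2) = minDist U}
    (fun ⟨X, hX⟩ => h ⟨X, lengthensContacts_zero.2 fun i j hij hd => hX (i, j) ⟨hij, hd⟩⟩)
  -- Gordan's weights live on ordered pairs; each edge receives the sum over its two orientations.
  let W : Fin N → Fin N → ℝ := fun i j => w (i, j) + w (j, i)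
  have hWcomm : ∀ i j, W i j = W j i := fun i j => add_comm _ _
  have hforce : ∀ i, ∑ j, W i j • tangentTo (U i) (U j) = 0 := by
    set F : Fin N → EuclideanSpace ℝ (Fin 3) := fun i => ∑ j, W i j • tangentTo (U i) (U j) with hF
    have hsum : ∑ i, ⟪F i, F i⟫_ℝ = 0 := by
      -- Testing the weights against the net force itself yields the sum of the squared norms of the
      -- forces.
      have hS := h0 F
      simp only [hL, Fintype.sum_prod_type, mul_add, Finset.sum_add_distrib] at hS
      rw [Finset.sum_comm (f := fun i j => w (i, j) * ⟪F j, tangentTo (U j) (U i)⟫_ℝ),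
        ← Finset.sum_add_distrib] at hS
      rw [← hS]
      refine Finset.sum_congr rfl fun i _ => ?_
      have : ⟪F i, F i⟫_ℝ = ⟪F i, ∑ j, W i j • tangentTo (U i) (U j)⟫_ℝ := rfl
      rw [this, inner_sum, ← Finset.sum_add_distrib]
      refine Finset.sum_congr rfl fun j _ => ?_
      rw [real_inner_smul_right, add_mul]
    intro i
    have := (Finset.sum_eq_zero_iff_of_nonneg fun i _ => real_inner_self_nonneg).1 hsum i
      (Finset.mem_univ i)
    exact inner_self_eq_zero.1 this
  have hadj : ∀ i j, (contactGraph (2 * injRadius U) U).Adj (U i) (U j) ↔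
      i ≠ j ∧ angDist (U i) (U j) = minDist U := by
    intro i j
    rw [two_mul_injRadius]
    exact ⟨fun h => ⟨fun hij => h.2.2.1 (congrArg U hij), h.2.2.2⟩,
      fun h => ⟨⟨i, rfl⟩, ⟨j, rfl⟩, hinj.ne h.1, h.2⟩⟩
  have hW0 : ∀ i j, ¬ (i ≠ j ∧ angDist (U i) (U j) = minDist U) → W i j = 0 := by
    intro i j hij
    have hji : ¬ (j ≠ i ∧ angDist (U j) (U i) = minDist U) := by
      rwa [ne_comm, angDist_comm]
    simp only [W]
    rw [hws (i, j) hij, hws (j, i) hji, add_zero]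
  let ω : Sym2 S2 → ℝ := Sym2.lift ⟨fun x y => W (Function.invFun U x) (Function.invFun U y),
    fun x y => hWcomm _ _⟩
  have hω : ∀ i j, ω s(U i, U j) = W i j := fun i j => by
    simp only [ω, Sym2.lift_mk, Function.leftInverse_invFun hinj i,
      Function.leftInverse_invFun hinj j]
  refine ⟨hinj, ω, ⟨fun e _ => ?_, fun i => ?_⟩, s(U a, U b),
    SimpleGraph.Subgraph.mem_edgeSet.2 ((hadj a b).2 hab), ?_⟩
  · induction e with
    | _ x y => exact add_nonneg (hw _) (hw _)
  · have hterm : ∀ j ∈ Finset.univ.filter fun j => (contactGraph (2 * injRadius U) U).Adj (U i) (U j),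
        ω s(U i, U j) • outwardTangent (U i) (U j) =
          -((√(1 - Real.cos (minDist U) ^ 2))⁻¹ • (W i j • tangentTo (U i) (U j))) := by
      intro j hj
      rw [Finset.mem_filter, hadj] at hj
      rw [hω, outwardTangent_eq, hj.2.2, smul_neg, smul_comm]
    have hfilter : ∑ j with (contactGraph (2 * injRadius U) U).Adj (U i) (U j),
        W i j • tangentTo (U i) (U j) = 0 := by
      rw [← hforce i]
      refine Finset.sum_subset (Finset.subset_univ _) fun j _ hj => ?_
      rw [Finset.mem_filter, hadj] at hj
      rw [hW0 i j fun h => hj ⟨Finset.mem_univ j, h⟩, zero_smul]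
    refine (Finset.sum_congr (by congr) hterm).trans ?_
    rw [Finset.sum_neg_distrib, ← Finset.smul_sum, hfilter, smul_zero, neg_zero]
  · rw [hω]
    exact (add_pos_of_pos_of_nonneg ((hw _).lt_of_ne' hwab) (hw _)).ne'

/-! ### Critical configurations -/

theorem eventually_lt_of_innerRate_neg {N : ℕ} {U : Fin N → S2}
    {X : Fin N → EuclideanSpace ℝ (Fin 3)} {t : ℝ} {i j : Fin N} {c : ℝ}
    (h : innerRate U X t i j < -c) : ∀ᶠ s in 𝓝[>] t,
      ⟪(push U X s i : EuclideanSpace ℝ (Fin 3)), (push U X s j : EuclideanSpace ℝ (Fin 3))⟫_ℝ <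
      ⟪(push U X t i : EuclideanSpace ℝ (Fin 3)), (push U X t j : EuclideanSpace ℝ (Fin 3))⟫_ℝ -
        c * (s - t) := by
  have := (hasDerivAt_inner_push U X t i j).hasDerivWithinAt.limsup_slope_le' (s := Set.Ioi t)
    (by simp) h
  filter_upwards [this, self_mem_nhdsWithin] with s hs hts
  rw [slope_def_field, div_lt_iff₀ (sub_pos.2 hts)] at hs
  linarith

/-- A critical configuration has no variation that lengthens all edges of its contact graph to first
order. -/
theorem IsCritical.not_lengthensContacts {N : ℕ} {U : Fin N → S2} (hN : 2 ≤ N) (hU : IsCritical U)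
    (X : Fin N → EuclideanSpace ℝ (Fin 3)) : ¬ LengthensContacts U X 0 := by
  intro hX
  rw [lengthensContacts_zero] at hX
  have hcont : Continuous fun t => push U X t :=
    continuous_push continuous_const continuous_const continuous_id
  have hpair : ∀ i j, i ≠ j → ∀ᶠ c in 𝓝[>] (0 : ℝ), ∀ᶠ t in 𝓝[>] (0 : ℝ),
      minDist U + c * t ≤ angDist (push U X t i) (push U X t j) := by
    intro i j hij
    rcases (minDist_le U hij).eq_or_lt with he | hlt
    · have h1 := hX i j hij he.symm
      have : ∀ᶠ c in 𝓝 (0 : ℝ), innerRate U X 0 i j < -c :=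
        continuous_neg.continuousAt.eventually (eventually_gt_nhds (by simpa using h1))
      filter_upwards [this.filter_mono nhdsWithin_le_nhds, self_mem_nhdsWithin] with c hc hc0
      filter_upwards [eventually_lt_of_innerRate_neg hc, self_mem_nhdsWithin] with t ht ht0
      rw [push_zero, sub_zero, ← cos_angDist, ← cos_angDist] at ht
      have hct : 0 < c * t := mul_pos hc0 ht0
      have hlt : angDist (U i) (U j) < angDist (push U X t i) (push U X t j) := by
        rw [angDist_lt_angDist_iff, ← cos_angDist, ← cos_angDist]; linarith
      -- Cosine is 1-Lipschitz, so the angle grows at least as much as the inner product drops.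
      have := (le_abs_self _).trans
        (Real.abs_cos_sub_cos_le (angDist (U i) (U j)) (angDist (push U X t i) (push U X t j)))
      rw [abs_sub_comm, abs_of_pos (sub_pos.2 hlt)] at this
      linarith
    · filter_upwards with c
      have h1 : ContinuousAt (fun t => angDist (push U X t i) (push U X t j) - c * t) 0 :=
        ((continuous_angDist ((continuous_apply i).comp hcont)
          ((continuous_apply j).comp hcont)).sub (continuous_const.mul continuous_id)).continuousAt
      have h2 := h1.eventually (lt_mem_nhds (a := minDist U) (by simpa [push_zero] using hlt))
      filter_upwards [h2.filter_mono nhdsWithin_le_nhds] with t ht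
      linarith
  have hall : ∀ᶠ c in 𝓝[>] (0 : ℝ), ∀ i j, i ≠ j → ∀ᶠ t in 𝓝[>] (0 : ℝ),
      minDist U + c * t ≤ angDist (push U X t i) (push U X t j) := by
    simp only [Filter.eventually_all]
    exact hpair
  obtain ⟨c, hc, hc0 : 0 < c⟩ := (hall.and self_mem_nhdsWithin).exists
  have hmin : ∀ᶠ t in 𝓝[>] (0 : ℝ), minDist U + c * t ≤ minDist (push U X t) := by
    simp only [le_minDist_iff hN, Filter.eventually_all]
    exact hc
  -- `injRadius` is half of `minDist`, hence gains at least `c / 2 * t`; any constant below `c / 2`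
  -- contradicts criticality.
  have hlo := ((hU.2 fun i => tanProj (U i) (X i)).def (c := c / 4) (by linarith)).filter_mono
    (nhdsWithin_le_nhds (s := Set.Ioi 0))
  obtain ⟨t, ⟨ht, hlt⟩, ht0 : 0 < t⟩ := ((hmin.and hlo).and self_mem_nhdsWithin).exists
  have h1 := (le_max_left _ 0).trans ((le_abs_self _).trans hlt)
  rw [Real.norm_eq_abs, abs_of_pos ht0] at h1
  have h2 := two_mul_injRadius U
  have h3 := two_mul_injRadius (push U X t)
  change injRadius (push U X t) - injRadius U ≤ _ at h1
  nlinarith [mul_pos hc0 ht0]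

/-! ### Deformation retraction of superlevel sets -/

/-- A maximum over `[s, t]` can only sit at `t`, since `f` exceeds its value immediately to the
right of any earlier point. -/
theorem strictMonoOn_of_eventually_lt {f : ℝ → ℝ} {a b : ℝ} (hf : ContinuousOn f (Set.Icc a b))
    (h : ∀ r ∈ Set.Ico a b, ∀ᶠ z in 𝓝[>] r, f r < f z) : StrictMonoOn f (Set.Icc a b) := by
  intro s hs t ht hst
  obtain ⟨r, hr, hmax⟩ := isCompact_Icc.exists_isMaxOn (Set.nonempty_Icc.2 hst.le)
    (hf.mono (Set.Icc_subset_Icc hs.1 ht.2))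
  have hrt : r = t := by
    by_contra hne
    have hlt : r < t := lt_of_le_of_ne hr.2 hne
    obtain ⟨z, hz, hzr, hzt⟩ := ((h r ⟨hs.1.trans hr.1, hlt.trans_le ht.2⟩).and
      (Ioo_mem_nhdsGT hlt)).exists
    exact (hmax ⟨hr.1.trans hzr.le, hzt.le⟩).not_gt hz
  subst hrt
  obtain ⟨z, hz, hzs, hzt⟩ := ((h s ⟨hs.1, hst.trans_le ht.2⟩).and (Ioo_mem_nhdsGT hst)).exists
  exact hz.trans_le (hmax ⟨hzs.le, hzt.le⟩)

/-- If `Φ` strictly increases `f` on the slab `a ≤ f ≤ b` and carries it above `b` in time `τ`, then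
the superlevel set of `f` at `a` deformation retracts onto the one at `b`. -/
theorem deformationRetractsOnto_superlevel {M : Type*} [TopologicalSpace M] {f : M → ℝ}
    (hf : Continuous f) {Φ : M × ℝ → M} (hΦ : Continuous Φ) (hΦ0 : ∀ x, Φ (x, 0) = x) {a b τ : ℝ}
    (hab : a ≤ b) (hτ : 0 ≤ τ)
    (hmono : ∀ x, f x ∈ Set.Icc a b → StrictMonoOn (fun t => f (Φ (x, t))) (Set.Icc 0 τ))
    (hreach : ∀ x, f x ∈ Set.Icc a b → b ≤ f (Φ (x, τ))) :
    DeformationRetractsOnto {x | a ≤ f x} {x | b ≤ f x} := by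
  -- The graph of the hitting time of level `b`, set to `0` above it. Both clauses force time `0`
  -- where `f = b`.
  let G : Set ({x | a ≤ f x} × Set.Icc 0 τ) :=
    {p | (b ≤ f p.1 ∧ (p.2 : ℝ) = 0) ∨ (f p.1 ≤ b ∧ f (Φ (p.1, p.2)) = b)}
  have hG : IsClosed G := by
    refine IsClosed.union (IsClosed.inter ?_ ?_) (IsClosed.inter ?_ ?_)
    · exact isClosed_le continuous_const (hf.comp (continuous_subtype_val.comp continuous_fst))
    · exact isClosed_eq (continuous_subtype_val.comp continuous_snd) continuous_const
    · exact isClosed_le (hf.comp (continuous_subtype_val.comp continuous_fst)) continuous_const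
    · exact isClosed_eq (hf.comp (hΦ.comp ((continuous_subtype_val.comp continuous_fst).prodMk
        (continuous_subtype_val.comp continuous_snd)))) continuous_const
  have hex : ∀ x : {x | a ≤ f x}, ∃ t : Set.Icc 0 τ, (x, t) ∈ G := by
    rintro ⟨x, hx⟩
    rcases le_total b (f x) with hb | hb
    · exact ⟨⟨0, le_rfl, hτ⟩, Or.inl ⟨hb, rfl⟩⟩
    · obtain ⟨t, ht, hft⟩ := intermediate_value_Icc hτ
        (f := fun t => f (Φ (x, t))) (by fun_prop) (show b ∈ Set.Icc _ _ from
          ⟨by simpa [hΦ0] using hb, hreach x ⟨hx, hb⟩⟩)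
      exact ⟨⟨t, ht⟩, Or.inr ⟨hb, hft⟩⟩
  have huniq : ∀ (x : {x | a ≤ f x}) (s t : Set.Icc 0 τ), (x, s) ∈ G → (x, t) ∈ G → s = t := by
    rintro ⟨x, hx⟩ ⟨s, hs⟩ ⟨t, ht⟩ h1 h2
    have h0 : (0 : ℝ) ∈ Set.Icc 0 τ := ⟨le_rfl, hτ⟩
    have hbase : b ≤ f x → f x ≤ b → f (Φ (x, 0)) = b := fun h h' => by
      rw [hΦ0]; exact le_antisymm h' h
    apply Subtype.ext
    rcases h1 with ⟨hb, hs0⟩ | ⟨hb, hs0⟩ <;> rcases h2 with ⟨hb', ht0⟩ | ⟨hb', ht0⟩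
    · exact hs0.trans ht0.symm
    · refine hs0.trans ((hmono x ⟨hx, hb'⟩).injOn h0 ht ?_)
      exact (hbase hb hb').trans ht0.symm
    · refine ((hmono x ⟨hx, hb⟩).injOn hs h0 ?_).trans ht0.symm
      exact hs0.trans (hbase hb' hb).symm
    · exact (hmono x ⟨hx, hb⟩).injOn hs ht (hs0.trans ht0.symm)
  choose T hT using hex
  -- A function with closed graph and compact codomain is continuous.
  have hTc : Continuous T := by
    rw [continuous_iff_isClosed]
    intro C hC
    have : T ⁻¹' C = Prod.fst '' (G ∩ Prod.snd ⁻¹' C) := by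
      ext x
      constructor
      · intro hx
        exact ⟨(x, T x), ⟨hT x, hx⟩, rfl⟩
      · rintro ⟨⟨y, t⟩, ⟨hy, ht⟩, rfl⟩
        exact (huniq y t (T y) hy (hT y)) ▸ ht
    rw [this]
    exact isClosedMap_fst_of_compactSpace _ (hG.inter (hC.preimage continuous_snd))
  have hT0 : ∀ x : {x | a ≤ f x}, b ≤ f x → (T x : ℝ) = 0 := fun x hx =>
    congrArg Subtype.val (huniq x (T x) ⟨0, le_rfl, hτ⟩ (hT x) (Or.inl ⟨hx, rfl⟩))
  have hmem : ∀ (s : unitInterval) (x : {x | a ≤ f x}), a ≤ f (Φ (x, s * T x)) := by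
    intro s x
    rcases le_total b (f x) with hb | hb
    · rw [hT0 x hb, mul_zero, hΦ0]; exact x.2
    · have h1 : (0 : ℝ) ≤ s * T x := mul_nonneg s.2.1 (T x).2.1
      have h2 : (s * T x : ℝ) ≤ τ := (mul_le_of_le_one_left (T x).2.1 s.2.2).trans (T x).2.2
      have := (hmono x ⟨x.2, hb⟩).monotoneOn ⟨le_rfl, hτ⟩ ⟨h1, h2⟩ h1
      simp only [hΦ0] at this
      exact x.2.trans this
  let H : unitInterval × {x | a ≤ f x} → {x | a ≤ f x} := fun p =>
    ⟨Φ (p.2, p.1 * T p.2), hmem p.1 p.2⟩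
  have hH : Continuous H := Continuous.subtype_mk (by fun_prop) _
  refine ⟨fun x hx => hab.trans hx, ⟨fun x => H (1, x), by fun_prop⟩, fun x => ?_,
    ⟨{ toFun := H
       continuous_toFun := hH
       map_zero_left := fun x => ?_
       map_one_left := fun x => rfl
       prop' := fun s x hx => ?_ }⟩⟩
  · change b ≤ f (Φ (x, (1 : unitInterval) * T x))
    rw [Set.Icc.coe_one, one_mul]
    rcases hT x with ⟨hb, h0⟩ | ⟨-, h⟩
    · rw [h0, hΦ0]; exact hb
    · exact h.ge
  · apply Subtype.ext
    change Φ (x, (0 : unitInterval) * T x) = x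
    rw [Set.Icc.coe_zero, zero_mul, hΦ0]
  · apply Subtype.ext
    change Φ (x, s * T x) = x
    rw [hT0 x hx, mul_zero, hΦ0]

/-! ### Lengthening variations near a level -/

section

variable {N : ℕ}

/-- For each pair, either not being a contact or having negative rate is an open condition. -/
theorem isOpen_lengthensContacts (hN : 2 ≤ N) {Y : Type*} [TopologicalSpace Y]
    {U : Y → Fin N → S2} {X : Y → Fin N → EuclideanSpace ℝ (Fin 3)} {t : Y → ℝ}
    (hU : Continuous U) (hX : Continuous X) (ht : Continuous t) :
    IsOpen {y | LengthensContacts (U y) (X y) (t y)} := by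
  have hp := continuous_push hU hX ht
  have : {y | LengthensContacts (U y) (X y) (t y)} = ⋂ (i) (j) (_ : i ≠ j),
      ({y | angDist (push (U y) (X y) (t y) i) (push (U y) (X y) (t y) j) ≠
        minDist (push (U y) (X y) (t y))} ∪ {y | innerRate (U y) (X y) (t y) i j < 0}) := by
    ext y
    simp only [LengthensContacts, Set.mem_iInter, Set.mem_union, Set.mem_ofPred_eq, imp_iff_not_or,
      ne_eq]
  rw [this]
  refine isOpen_iInter_of_finite fun i => isOpen_iInter_of_finite fun j =>
    isOpen_iInter_of_finite fun _ => IsOpen.union ?_ ?_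
  · exact isOpen_ne_fun (continuous_angDist ((continuous_apply i).comp hp)
      ((continuous_apply j).comp hp)) ((continuous_minDist hN).comp hp)
  · exact isOpen_lt (continuous_innerRate hU hX ht i j) continuous_const

theorem convex_lengthensContacts (U : Fin N → S2) : Convex ℝ {X | LengthensContacts U X 0} := by
  intro X hX Y hY a b ha hb hab
  simp only [Set.mem_ofPred_eq, lengthensContacts_zero] at *
  intro i j hij hd
  have h1 := hX i j hij hd
  have h2 := hY i j hij hd
  have : innerRate U (a • X + b • Y) 0 i j = a * innerRate U X 0 i j + b * innerRate U Y 0 i j := by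
    simp only [innerRate_zero_eq, Pi.add_apply, Pi.smul_apply, inner_add_left,
      real_inner_smul_left]
    ring
  rw [this]
  exact (convex_Iio (0 : ℝ)) h1 h2 ha hb hab

/-- Just after any time, contact pairs have become longer and the others stay above the old minimum
by continuity. -/
theorem strictMonoOn_minDist_push (hN : 2 ≤ N) {U : Fin N → S2}
    {X : Fin N → EuclideanSpace ℝ (Fin 3)} {τ : ℝ}
    (h : ∀ t ∈ Set.Icc 0 τ, LengthensContacts U X t) :
    StrictMonoOn (fun t => minDist (push U X t)) (Set.Icc 0 τ) := by
  have hp : Continuous fun t => push U X t :=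
    continuous_push continuous_const continuous_const continuous_id
  refine strictMonoOn_of_eventually_lt ((continuous_minDist hN).comp hp).continuousOn fun r hr => ?_
  simp only [lt_minDist_iff hN, Filter.eventually_all]
  intro i j hij
  rcases (minDist_le (push U X r) hij).eq_or_lt with he | hlt
  · filter_upwards [eventually_lt_of_innerRate_neg (c := 0)
      (by simpa using h r ⟨hr.1, hr.2.le⟩ i j hij he.symm)] with s hs
    rw [he, angDist_lt_angDist_iff]
    simpa using hs
  · exact ((continuous_angDist ((continuous_apply i).comp hp)
      ((continuous_apply j).comp hp)).continuousAt.eventually (lt_mem_nhds hlt)).filter_mono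
      nhdsWithin_le_nhds

/-- The values of `minDist` off `O` form a compact set missing `ℓ`, hence lie at positive distance
from it. An empty level is included. -/
theorem exists_pos_forall_near_level (hN : 2 ≤ N) {O : Set (Fin N → S2)} (hO : IsOpen O) {ℓ : ℝ}
    (h : ∀ U, minDist U = ℓ → U ∈ O) : ∃ δ > 0, ∀ U, |minDist U - ℓ| ≤ δ → U ∈ O := by
  have hcl : IsClosed (minDist '' Oᶜ) :=
    (hO.isClosed_compl.isCompact.image (continuous_minDist hN)).isClosed
  have hnot : ℓ ∉ minDist '' Oᶜ := by
    rintro ⟨U, hU, he⟩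
    exact hU (h U he)
  obtain ⟨δ, hδ, hb⟩ := Metric.isOpen_iff.1 hcl.isOpen_compl _ hnot
  refine ⟨δ / 2, half_pos hδ, fun U hU => ?_⟩
  by_contra hUO
  refine hb (Metric.mem_ball.2 ?_) ⟨U, hUO, rfl⟩
  rw [Real.dist_eq]
  linarith

theorem isOpen_exists_lengthensContacts (hN : 2 ≤ N) :
    IsOpen {U : Fin N → S2 | ∃ X, LengthensContacts U X 0} := by
  have : {U : Fin N → S2 | ∃ X, LengthensContacts U X 0} =
      ⋃ X, {U | LengthensContacts U X 0} := by ext U; simp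
  rw [this]
  exact isOpen_iUnion fun X =>
    isOpen_lengthensContacts hN continuous_id continuous_const continuous_const

/-- By openness a variation good at one configuration is good nearby; by convexity these local
choices can be averaged. Off `K` any value is allowed. -/
theorem exists_continuous_lengthensContacts (hN : 2 ≤ N) {K : Set (Fin N → S2)} (hK : IsClosed K)
    (h : ∀ U ∈ K, ∃ X, LengthensContacts U X 0) :
    ∃ X : C(Fin N → S2, Fin N → EuclideanSpace ℝ (Fin 3)),
      ∀ U ∈ K, LengthensContacts U (X U) 0 := by
  refine exists_continuous_forall_mem_convex_of_local_const
    (t := fun U => {x | U ∈ K → LengthensContacts U x 0}) (fun U => ?_) fun U => ?_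
  · by_cases hU : U ∈ K
    · simpa [hU] using convex_lengthensContacts U
    · simpa [hU] using convex_univ
  · by_cases hU : U ∈ K
    · obtain ⟨x, hx⟩ := h U hU
      have hopen : IsOpen {V : Fin N → S2 | LengthensContacts V x 0} :=
        isOpen_lengthensContacts hN continuous_id continuous_const continuous_const
      exact ⟨x, Filter.mem_of_superset (hopen.mem_nhds hx) fun V hV _ => hV⟩
    · exact ⟨0, Filter.mem_of_superset (hK.isOpen_compl.mem_nhds hU) fun V hV hVK =>
        absurd hVK hV⟩

theorem exists_pos_forall_lengthensContacts (hN : 2 ≤ N) {K : Set (Fin N → S2)} (hK : IsCompact K)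
    {X : (Fin N → S2) → Fin N → EuclideanSpace ℝ (Fin 3)} (hXc : Continuous X)
    (hX : ∀ U ∈ K, LengthensContacts U (X U) 0) :
    ∃ τ > 0, ∀ U ∈ K, ∀ t ∈ Set.Icc 0 τ, LengthensContacts U (X U) t := by
  have hopen : IsOpen {q : ℝ × (Fin N → S2) | LengthensContacts q.2 (X q.2) q.1} :=
    isOpen_lengthensContacts hN continuous_snd (hXc.comp continuous_snd) continuous_fst
  have hev : ∀ᶠ t in 𝓝 (0 : ℝ), ∀ U ∈ K, LengthensContacts U (X U) t :=
    hK.eventually_forall_of_forall_eventually fun U hU =>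
      hopen.mem_nhds (show (0, U) ∈ {q : ℝ × (Fin N → S2) | LengthensContacts q.2 (X q.2) q.1}
        from hX U hU)
  obtain ⟨r, hr, hrb⟩ := Metric.eventually_nhds_iff_ball.1 hev
  refine ⟨r / 2, half_pos hr, fun U hU t ht => hrb t ?_ U hU⟩
  rw [Metric.mem_ball, dist_zero_right, Real.norm_of_nonneg ht.1]
  linarith [ht.2]

/-- A level at which every configuration has a variation that lengthens all edges of its contact
graph to first order is topologically regular. -/
theorem isTopologicallyRegularValue_of_lengthensContacts (hN : 2 ≤ N) {c : ℝ} (hc : 0 < c)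
    (h : ∀ U : Fin N → S2, minDist U = 2 * c → ∃ X, LengthensContacts U X 0) :
    IsTopologicallyRegularValue N c := by
  have hcm := continuous_minDist hN
  obtain ⟨δ, hδ, hball⟩ :=
    exists_pos_forall_near_level hN (isOpen_exists_lengthensContacts hN) h
  let K : Set (Fin N → S2) := {U | |minDist U - 2 * c| ≤ δ}
  have hK : IsClosed K := isClosed_le (hcm.sub continuous_const).abs continuous_const
  obtain ⟨X, hX⟩ := exists_continuous_lengthensContacts hN hK hball
  have hpush : Continuous fun p : (Fin N → S2) × ℝ => push p.1 (X p.1) p.2 :=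
    continuous_push continuous_fst (X.continuous.comp continuous_fst) continuous_snd
  obtain ⟨τ, hτ, hL⟩ := exists_pos_forall_lengthensContacts hN hK.isCompact X.continuous hX
  have hmono : ∀ U ∈ K, StrictMonoOn (fun t => minDist (push U (X U) t)) (Set.Icc 0 τ) :=
    fun U hU => strictMonoOn_minDist_push hN (hL U hU)
  obtain ⟨η, hη, hgain⟩ : ∃ η, 0 < η ∧ ∀ U ∈ K, η ≤ minDist (push U (X U) τ) - minDist U := by
    have hτc : Continuous fun U => push U (X U) τ :=
      continuous_push continuous_id X.continuous continuous_const
    refine hK.isCompact.exists_forall_le' (((hcm.comp hτc).sub hcm).continuousOn) fun U hU => ?_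
    have := hmono U hU ⟨le_rfl, hτ.le⟩ ⟨hτ.le, le_rfl⟩ hτ
    simp only [push_zero] at this
    exact sub_pos.2 this
  -- In terms of `minDist` the slab has half-width `2 * ε < δ`, so it lies in `K`, and width `4 * ε
  -- < η`, so time `τ` suffices to cross it.
  obtain ⟨ε, hε, hε1⟩ : ∃ ε : ℝ, 0 < ε ∧ ε < min (min (δ / 2) (η / 4)) c :=
    exists_between (lt_min (lt_min (by linarith) (by linarith)) hc)
  obtain ⟨hε2, hεc⟩ := lt_min_iff.1 hε1
  obtain ⟨hεδ, hεη⟩ := lt_min_iff.1 hε2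
  refine ⟨ε, hε, hεc, ?_⟩
  have hsets : ∀ r, 0 < r → ConfGE N r = {U | r ≤ minDist U} := fun r hr =>
    Set.ext fun U => mem_ConfGE_iff hN hr
  rw [hsets _ (by linarith), hsets _ (by linarith)]
  have hslab : ∀ U : Fin N → S2, minDist U ∈ Set.Icc (2 * (c - ε)) (2 * (c + ε)) → U ∈ K := by
    rintro U ⟨h1, h2⟩
    change |minDist U - 2 * c| ≤ δ
    rw [abs_le]
    constructor <;> linarith
  refine deformationRetractsOnto_superlevel hcm hpush (fun U => push_zero U (X U)) (by linarith)
    hτ.le (fun U hU => hmono U (hslab U hU)) fun U hU => ?_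
  have := hgain U (hslab U hU)
  have := hU.1
  dsimp only
  linarith

end

end SphereConf

theorem theorem4p9 (N : ℕ) (hN : 3 ≤ N) (θ : ℝ) (hθ : 0 < θ)
    (hcrit : SphereConf.IsCriticalValue N (θ / 2)) :
    ∃ U : Fin N → SphereConf.S2,
      SphereConf.IsBalanced U ∧ SphereConf.injRadius U = θ / 2 ∧
      (SphereConf.contactGraph (2 * SphereConf.injRadius U) U).verts ⊆ Set.range U ∧
      ∀ x y : SphereConf.S2,
        (SphereConf.contactGraph (2 * SphereConf.injRadius U) U).Adj x y →
          SphereConf.angDist x y = θ := by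
  have hN2 : 2 ≤ N := by omega
  obtain ⟨U, hU, hno⟩ : ∃ U : Fin N → SphereConf.S2, SphereConf.minDist U = θ ∧
      ¬ ∃ X, SphereConf.LengthensContacts U X 0 := by
    rcases hcrit with ⟨U, hU, hr⟩ | hreg
    · exact ⟨U, by rw [← SphereConf.two_mul_injRadius, hr]; ring,
        fun ⟨X, hX⟩ => hU.not_lengthensContacts hN2 X hX⟩
    · by_contra! hall
      exact hreg (SphereConf.isTopologicallyRegularValue_of_lengthensContacts hN2 (by linarith)
        fun U hU => hall U (by linarith))
  have hrad : 2 * SphereConf.injRadius U = θ := (SphereConf.two_mul_injRadius U).trans hU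
  exact ⟨U, SphereConf.isBalanced_of_not_lengthensContacts hN2 (by linarith) hno, by linarith,
    subset_rfl, fun x y hxy => hxy.2.2.2.trans hrad⟩
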